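/- Let $n\ge 8$ and let $P_{n+2}$ be a convex polygon with $n+2$ vertices. A triangulation of $P_{n+2}$ is a subdivision of it into triangles by pairwise non-crossing diagonals; it is a fan triangulation if all its diagonals are incident with a common vertex. A 2-coloured triangulation is a triangulation together with one of two colours for each of its triangles. If a diagonal $t$ of a 2-coloured triangulation is incident with two triangles of the same colour, the 2-coloured flip at $t$ replaces $t$ by the other diagonal $t'$ of the quadrilateral formed by these two triangles, gives the two triangles incident with $t'$ the other colour, and leaves all other triangles and their colours unchanged. The 2-coloured flip graph of $P_{n+2}$ is the graph whose vertices are the 2-coloured triangulations of $P_{n+2}$ and whose edges correspond to 2-coloured flips. Then the 2-coloured flip graph of $P_{n+2}$ has a connected component which is not planar. More precisely, $P_{n+2}$ has 2-coloured fan triangulations in which all triangles have the same colour, and for each of them the connected component of the 2-coloured flip graph that contains it has a subgraph isomorphic to the 4-dimensional hypercube graph, and is not planar. The 4-dimensional hypercube graph itself is not planar. -/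

import Mathlib

open scoped unitInterval SimpleGraph

namespace FlipGraph

/-! The vertices of the convex polygon with `n + 2` vertices are the elements of `Fin (n + 2)`,
in their cyclic order. A segment between two vertices is an element of `Sym2 (Fin (n + 2))`. -/

/-- A boundary segment of the polygon. -/
def IsSide {n : ℕ} (e : Sym2 (Fin (n + 2))) : Prop :=
  ∃ i : Fin (n + 2), e = s(i, i + 1)

/-- A diagonal of the polygon: a segment between two different vertices that is not a
boundary segment. -/
def IsDiagonal {n : ℕ} (e : Sym2 (Fin (n + 2))) : Prop :=
  ¬ e.IsDiag ∧ ¬ IsSide e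

/-- Two segments cross (in their relative interiors): their endpoints alternate in the cyclic
order of the vertices. -/
def Crosses {n : ℕ} (e e' : Sym2 (Fin (n + 2))) : Prop :=
  ∃ a b c d : Fin (n + 2), e = s(a, c) ∧ e' = s(b, d) ∧ sbtw a b c ∧ sbtw c d a

/-- A triangulation of the polygon with `n + 2` vertices, given by its diagonals: they are
pairwise non-crossing and subdivide the polygon into triangles, that is, no further diagonal
can be drawn without crossing one of them. -/
structure Triangulation (n : ℕ) where
  diagonals : Finset (Sym2 (Fin (n + 2)))
  isDiagonal : ∀ e ∈ diagonals, IsDiagonal e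
  not_crosses : ∀ e ∈ diagonals, ∀ e' ∈ diagonals, ¬ Crosses e e'
  maximal : ∀ e, IsDiagonal e → (∀ e' ∈ diagonals, ¬ Crosses e e') → e ∈ diagonals

namespace Triangulation

/-- The triangles (faces) of a triangulation, given by their sets of vertices: three vertices
that are joined pairwise by boundary segments or by diagonals of the triangulation. -/
def IsFace {n : ℕ} (T : Triangulation n) (f : Finset (Fin (n + 2))) : Prop :=
  f.card = 3 ∧ ∀ a ∈ f, ∀ b ∈ f, a ≠ b → IsSide s(a, b) ∨ s(a, b) ∈ T.diagonals

/-- A fan triangulation: all diagonals are incident with a common vertex. -/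
def IsFan {n : ℕ} (T : Triangulation n) : Prop :=
  ∃ v : Fin (n + 2), ∀ e ∈ T.diagonals, v ∈ e

end Triangulation

/-- A 2-coloured triangulation: a triangulation with one of two colours (the elements of `Bool`)
for every triangle. The colouring is a partial function on sets of vertices that is defined
exactly on the triangles: `colour f = some i` says that `f` is a triangle of colour `i`. -/
structure ColouredTriangulation (n : ℕ) extends Triangulation n where
  colour : Finset (Fin (n + 2)) → Option Bool
  colour_isSome_iff : ∀ f, (colour f).isSome ↔ toTriangulation.IsFace f

namespace ColouredTriangulation

/-- All triangles have the same colour. -/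
def IsMonochromatic {n : ℕ} (X : ColouredTriangulation n) : Prop :=
  ∃ i : Bool, ∀ f, X.toTriangulation.IsFace f → X.colour f = some i

/-- `Y` is obtained from `X` by a 2-coloured flip: `ac` is a diagonal of `X` whose two incident
triangles `abc` and `acd` have the same colour `i`; in `Y` it is replaced by the other diagonal
`bd` of the quadrilateral `abcd`, the triangles `abd` and `bcd` incident with `bd` have the other
colour, and all other triangles keep their colours. -/
def IsFlip {n : ℕ} (X Y : ColouredTriangulation n) : Prop :=
  ∃ (a b c d : Fin (n + 2)) (i : Bool),
    b ≠ d ∧ s(a, c) ∈ X.diagonals ∧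
    X.colour {a, b, c} = some i ∧ X.colour {a, c, d} = some i ∧
    Y.diagonals = insert s(b, d) (X.diagonals.erase s(a, c)) ∧
    Y.colour {a, b, d} = some (!i) ∧ Y.colour {b, c, d} = some (!i) ∧
    ∀ f : Finset (Fin (n + 2)), f ≠ {a, b, c} → f ≠ {a, c, d} → f ≠ {a, b, d} → f ≠ {b, c, d} →
      Y.colour f = X.colour f

end ColouredTriangulation

/-- The 2-coloured flip graph of the polygon with `n + 2` vertices: its vertices are the
2-coloured triangulations, its edges correspond to 2-coloured flips. -/
def colouredFlipGraph (n : ℕ) : SimpleGraph (ColouredTriangulation n) :=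
  SimpleGraph.fromRel ColouredTriangulation.IsFlip

end FlipGraph

/-- The `k`-dimensional hypercube graph: binary words of length `k`, adjacent when they differ in
exactly one position. -/
def hypercubeGraph (k : ℕ) : SimpleGraph (Fin k → Bool) where
  Adj x y := hammingDist x y = 1
  symm := ⟨fun x y h => by rwa [hammingDist_comm] at h⟩
  loopless := ⟨fun x h => by simp at h⟩

/-- A graph is planar if it can be drawn in the Euclidean plane: the vertices are distinct
points, every edge `e` is an arc (an injective continuous image of the unit interval) between its
two endpoints, an arc passes through vertices only at its ends, and two different arcs meet only
at their ends. -/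
def SimpleGraph.IsPlanar {V : Type*} (G : SimpleGraph V) : Prop :=
  ∃ (point : V → EuclideanSpace ℝ (Fin 2)) (arc : Sym2 V → I → EuclideanSpace ℝ (Fin 2)),
    Function.Injective point ∧
    (∀ e ∈ G.edgeSet, Continuous (arc e) ∧ Function.Injective (arc e)) ∧
    (∀ e ∈ G.edgeSet, s(arc e 0, arc e 1) = e.map point) ∧
    (∀ e ∈ G.edgeSet, ∀ t v, arc e t = point v → t = 0 ∨ t = 1) ∧
    (∀ e ∈ G.edgeSet, ∀ e' ∈ G.edgeSet, e ≠ e' → ∀ t t', arc e t = arc e' t' →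
      (t = 0 ∨ t = 1) ∧ (t' = 0 ∨ t' = 1))

/-! In a monochromatic fan the diagonals from the apex to positions 2, 4, 6, 8 (counted from the
apex) lie in quadrilaterals with disjoint interiors. Flipping one of them recolours only the two
triangles of its own quadrilateral, so the four flips can be done and undone independently, and the
16 results form a 4-cube in the component of the fan (`isFlip_colouredFan`,
`hypercubeGraph_isContained_component`). The last position must be at most `n`, hence `n ≥ 8`.
Planarity passes to subgraphs, so it remains to see that the 4-cube is not planar. This is a van
Kampen argument with continuous logarithms in place of intersection theory. For disjoint arcs `f`,
`g`, the difference `g t - f s` has a continuous logarithm on the unit square, so its variation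
around the boundary vanishes (`HasLogVariation.add_eq_add`). Reduced mod 2, this gives one linear
equation over `ZMod 2` for each pair of independent edges, in unknowns indexed by a vertex and an
edge (`IsPlanar.exists_parity`). For a subdivided `K₃,₃` in the cube, the equations over all pairs
of paths without a common end add up to `0 = 1` (`not_isPlanar_of_list`). -/

/-! ### Continuous logarithms along arcs -/

instance : ContractibleSpace I :=
  (convex_Icc (0 : ℝ) 1).contractibleSpace ⟨0, by simp⟩

instance : LocallyPathConnectedSpace I :=
  (convex_Icc (0 : ℝ) 1).locallyPathConnectedSpace

/-- Along `f`, a continuous branch of `log (f - v)` grows by `w`. -/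
def HasLogVariation (v : ℂ) (f : I → ℂ) (w : ℂ) : Prop :=
  ∃ L : I → ℂ, Continuous L ∧ (∀ t, Complex.exp (L t) = f t - v) ∧ L 1 - L 0 = w

/-- A nowhere vanishing continuous function on a simply connected space has a continuous
logarithm. -/
theorem exists_continuous_log {A : Type*} [TopologicalSpace A] [SimplyConnectedSpace A]
    [LocallyPathConnectedSpace A] (f : A → ℂ) (hf : Continuous f) (h0 : ∀ a, f a ≠ 0) :
    ∃ L : A → ℂ, Continuous L ∧ ∀ a, Complex.exp (L a) = f a := by
  obtain ⟨a₀⟩ : Nonempty A := inferInstance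
  obtain ⟨F, ⟨-, hF⟩, -⟩ := Complex.isCoveringMap_exp.existsUnique_continuousMap_lifts
    (⟨fun a => ⟨f a, h0 a⟩, by fun_prop⟩ : C(A, {z : ℂ // z ≠ 0})) a₀ (Complex.log (f a₀))
    (by simp [Complex.exp_log (h0 a₀)])
  exact ⟨F, F.continuous, fun a => congrArg Subtype.val (congrFun hF a)⟩

/-- Both `L` and a translate of `M` lift the same path through the covering `exp` and agree at 0, so
they coincide. Hence variations do not depend on the branch, nor on a constant factor such as a
sign. -/
theorem sub_eq_sub_of_exp_eq_mul_exp {L M : I → ℂ} (hL : Continuous L) (hM : Continuous M) (z : ℂ)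
    (h : ∀ t, Complex.exp (L t) = z * Complex.exp (M t)) : L 1 - L 0 = M 1 - M 0 := by
  have key : L = fun t => M t + (L 0 - M 0) := by
    refine Complex.isCoveringMap_exp.eq_of_comp_eq hL (by fun_prop) ?_ 0 (by simp)
    funext t
    refine Subtype.ext ?_
    have h0 := h 0
    simp only [Function.comp, Complex.exp_add, Complex.exp_sub, h0, h t]
    field_simp [Complex.exp_ne_zero]
  have := congrFun key 1
  rw [this]; ring

/-- Prescribed logarithms at the two ends fix the variation up to full turns; the integer `k` later
becomes the unknown `N v e`. -/
theorem HasLogVariation.exists_eq {v : ℂ} {f : I → ℂ} {w x y : ℂ} (h : HasLogVariation v f w)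
    (hx : Complex.exp x = f 0 - v) (hy : Complex.exp y = f 1 - v) :
    ∃ k : ℤ, w = y - x + 2 * Real.pi * Complex.I * k := by
  obtain ⟨L, -, hL, rfl⟩ := h
  obtain ⟨m, hm⟩ := Complex.exp_eq_exp_iff_exists_int.1 ((hL 0).trans hx.symm)
  obtain ⟨k, hk⟩ := Complex.exp_eq_exp_iff_exists_int.1 ((hL 1).trans hy.symm)
  refine ⟨k - m, ?_⟩
  rw [hm, hk]; push_cast; ring

theorem exists_hasLogVariation {v : ℂ} {f : I → ℂ} (hf : Continuous f) (h : ∀ t, f t ≠ v) :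
    ∃ w, HasLogVariation v f w := by
  obtain ⟨L, hL, h'⟩ := exists_continuous_log (fun t => f t - v) (by fun_prop)
    (fun t => sub_ne_zero.2 (h t))
  exact ⟨_, L, hL, h', rfl⟩

/-- The total variation of `log (g t - f s)` around the unit square vanishes. -/
theorem HasLogVariation.add_eq_add {f g : I → ℂ} (hf : Continuous f) (hg : Continuous g)
    (hfg : ∀ s t, f s ≠ g t) {w₁ w₂ w₃ w₄ : ℂ}
    (h₁ : HasLogVariation (f 0) g w₁) (h₂ : HasLogVariation (f 1) g w₂)
    (h₃ : HasLogVariation (g 0) f w₃) (h₄ : HasLogVariation (g 1) f w₄) :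
    w₁ + w₄ = w₂ + w₃ := by
  obtain ⟨L, hL, h⟩ := exists_continuous_log (fun p : I × I => g p.2 - f p.1) (by fun_prop)
    (fun p => sub_ne_zero.2 (hfg _ _).symm)
  obtain ⟨L₁, c₁, e₁, rfl⟩ := h₁
  obtain ⟨L₂, c₂, e₂, rfl⟩ := h₂
  obtain ⟨L₃, c₃, e₃, rfl⟩ := h₃
  obtain ⟨L₄, c₄, e₄, rfl⟩ := h₄
  rw [sub_eq_sub_of_exp_eq_mul_exp c₁ (M := fun t => L (0, t)) (by fun_prop) 1
      (fun t => by rw [e₁, h]; ring),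
    sub_eq_sub_of_exp_eq_mul_exp c₂ (M := fun t => L (1, t)) (by fun_prop) 1
      (fun t => by rw [e₂, h]; ring),
    sub_eq_sub_of_exp_eq_mul_exp c₃ (M := fun t => L (t, 0)) (by fun_prop) (-1)
      (fun t => by rw [e₃, h]; ring),
    sub_eq_sub_of_exp_eq_mul_exp c₄ (M := fun t => L (t, 1)) (by fun_prop) (-1)
      (fun t => by rw [e₄, h]; ring)]
  ring

/-- Logarithms of all differences `z y - z x` of distinct points such that exchanging the points
changes the logarithm by `π * I`. -/
theorem exists_log_sub {V : Type*} [LinearOrder V] (z : V → ℂ) (hz : Function.Injective z) :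
    ∃ l : V → V → ℂ, (∀ x y, x ≠ y → Complex.exp (l x y) = z y - z x) ∧
      ∀ x y, x ≠ y →
        l x y - l y x = Real.pi * Complex.I * (2 * ((if y < x then 1 else 0 : ℤ) : ℂ) - 1) := by
  refine ⟨fun x y => if x < y then Complex.log (z y - z x) else
    Complex.log (z x - z y) + Real.pi * Complex.I, fun x y hxy => ?_, fun x y hxy => ?_⟩
  · have h1 : z y - z x ≠ 0 := sub_ne_zero.2 (hz.ne hxy.symm)
    have h2 : z x - z y ≠ 0 := sub_ne_zero.2 (hz.ne hxy)
    dsimp only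
    split_ifs
    · exact Complex.exp_log h1
    · rw [Complex.exp_add, Complex.exp_log h2, Complex.exp_pi_mul_I]; ring
  · rcases lt_or_gt_of_ne hxy with h | h
    · simp [h, h.not_gt]
    · simp [h, h.not_gt]; ring

/-! ### The parity obstruction to planarity -/

namespace SimpleGraph

theorem IsPlanar.of_isContained {V W : Type*} {G : SimpleGraph V} {H : SimpleGraph W}
    (hH : H.IsPlanar) (h : G ⊑ H) : G.IsPlanar := by
  obtain ⟨f⟩ := h
  obtain ⟨p, γ, hp, h1, h2, h3, h4⟩ := hH
  have hm : ∀ e ∈ G.edgeSet, e.map f ∈ H.edgeSet := fun e he => by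
    induction e with
    | _ x y => exact f.toHom.map_adj he
  refine ⟨p ∘ f, fun e => γ (e.map f), hp.comp f.injective, fun e he => h1 _ (hm e he),
    fun e he => by rw [h2 _ (hm e he), Sym2.map_map], fun e he t v => h3 _ (hm e he) t (f v),
    fun e he e' he' hne => h4 _ (hm e he) _ (hm e' he') ?_⟩
  exact fun h => hne (Sym2.map.injective f.injective h)

/-- In a planar drawing, with `N v e` the parity of the deviation of the winding of the edge `e`
around the vertex `v` from a standard value, the number of crossings of two independent edges,
which is zero, has the parity of the number of crossings in the convex drawing plus the four
relevant values of `N`. -/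
theorem IsPlanar.exists_parity {V : Type*} [LinearOrder V] {G : SimpleGraph V} (hG : G.IsPlanar) :
    ∃ N : V → Sym2 V → ZMod 2, ∀ a b c d, G.Adj a b → G.Adj c d →
      a ≠ c → a ≠ d → b ≠ c → b ≠ d →
      N a s(c, d) + N b s(c, d) + N c s(a, b) + N d s(a, b) =
        (if c < a then 1 else 0) + (if d < a then 1 else 0) + (if c < b then 1 else 0) +
          (if d < b then 1 else 0) := by
  obtain ⟨p, γ, hp, h1, h2, h3, h4⟩ := hG
  let φ : EuclideanSpace ℝ (Fin 2) ≃ₜ ℂ :=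
    (Complex.orthonormalBasisOneI.repr.symm.toHomeomorph)
  let z : V → ℂ := fun v => φ (p v)
  let g : Sym2 V → I → ℂ := fun e t => φ (γ e t)
  have hz : Function.Injective z := φ.injective.comp hp
  have hg : ∀ e ∈ G.edgeSet, Continuous (g e) := fun e he => φ.continuous.comp (h1 e he).1
  obtain ⟨l, hl, hl'⟩ := exists_log_sub z hz
  have hends : ∀ a b, G.Adj a b →
      (g s(a, b) 0 = z a ∧ g s(a, b) 1 = z b) ∨ (g s(a, b) 0 = z b ∧ g s(a, b) 1 = z a) := by
    intro a b hab
    have := h2 s(a, b) hab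
    rw [Sym2.map_mk, Sym2.eq_iff] at this
    simp only [g, z]
    rcases this with ⟨h, h'⟩ | ⟨h, h'⟩ <;> simp [h, h']
  have havoid : ∀ e ∈ G.edgeSet, ∀ v, v ∉ e → ∀ t, g e t ≠ z v := by
    intro e he v hv t h
    have h := φ.injective h
    induction e with
    | _ a b =>
      simp only [Sym2.mem_iff, not_or] at hv
      have h0 := h2 s(a, b) he
      rw [Sym2.map_mk, Sym2.eq_iff] at h0
      rcases h3 _ he t v h with rfl | rfl <;> rw [h] at h0 <;>
        simp only [hp.eq_iff] at h0 <;> tauto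
  -- The integer counts the full turns of the arc around `v` beyond the change prescribed by `l`.
  -- Its value 0 for non-edges and for incident pairs is never used.
  have hN : ∀ v e, ∃ k : ℤ, e ∈ G.edgeSet → v ∉ e → ∀ x y, g e 0 = z x → g e 1 = z y →
      HasLogVariation (z v) (g e) (l v y - l v x + 2 * Real.pi * Complex.I * k) := by
    intro v e
    by_cases he : e ∈ G.edgeSet
    swap
    · exact ⟨0, fun h => absurd h he⟩
    by_cases hv : v ∈ e
    · exact ⟨0, fun _ h => absurd hv h⟩
    induction e with
    | _ a b =>
    obtain ⟨w, hw⟩ := exists_hasLogVariation (hg _ he) (havoid _ he v hv)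
    simp only [Sym2.mem_iff, not_or] at hv
    obtain ⟨x, y, hx, hy, hvx, hvy⟩ : ∃ x y, g s(a, b) 0 = z x ∧ g s(a, b) 1 = z y ∧
        v ≠ x ∧ v ≠ y := by
      rcases hends a b he with h | h
      · exact ⟨a, b, h.1, h.2, hv.1, hv.2⟩
      · exact ⟨b, a, h.1, h.2, hv.2, hv.1⟩
    obtain ⟨k, hk⟩ := hw.exists_eq (x := l v x) (y := l v y) (by rw [hl v x hvx, hx])
      (by rw [hl v y hvy, hy])
    refine ⟨k, fun _ _ x' y' hx' hy' => ?_⟩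
    rw [hx] at hx'
    rw [hy] at hy'
    rw [← hz hx', ← hz hy', ← hk]
    exact hw
  choose N hN using hN
  have key : ∀ a b c d, G.Adj a b → G.Adj c d → a ≠ c → a ≠ d → b ≠ c → b ≠ d →
      g s(a, b) 0 = z a → g s(a, b) 1 = z b → g s(c, d) 0 = z c → g s(c, d) 1 = z d →
      N a s(c, d) - N b s(c, d) - N c s(a, b) + N d s(a, b) +
        ((if d < a then 1 else 0) + (if a < c then 1 else 0) + (if b < d then 1 else 0) +
          (if c < b then 1 else 0) - 2 : ℤ) = 0 := by
    intro a b c d hab hcd hac had hbc hbd e1 e2 e3 e4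
    have hav : a ∉ s(c, d) := by simp only [Sym2.mem_iff]; tauto
    have hbv : b ∉ s(c, d) := by simp only [Sym2.mem_iff]; tauto
    have hcv : c ∉ s(a, b) := by simp only [Sym2.mem_iff, eq_comm (a := c)]; tauto
    have hdv : d ∉ s(a, b) := by simp only [Sym2.mem_iff, eq_comm (a := d)]; tauto
    have hdis : ∀ s t, g s(a, b) s ≠ g s(c, d) t := by
      intro s t h
      have hne : s(a, b) ≠ s(c, d) := by
        rw [Ne, Sym2.eq_iff]; tauto
      rcases (h4 _ hab _ hcd hne s t (φ.injective h)).1 with rfl | rfl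
      · exact havoid _ hcd a hav t (by rw [← h, e1])
      · exact havoid _ hcd b hbv t (by rw [← h, e2])
    have hsq := HasLogVariation.add_eq_add (hg _ hab) (hg _ hcd) hdis
      (e1 ▸ hN a s(c, d) hcd hav c d e3 e4)
      (e2 ▸ hN b s(c, d) hcd hbv c d e3 e4)
      (e3 ▸ hN c s(a, b) hab hcv a b e1 e2)
      (e4 ▸ hN d s(a, b) hab hdv a b e1 e2)
    have i1 := hl' a d had
    have i2 := hl' c a hac.symm
    have i3 := hl' d b hbd.symm
    have i4 := hl' b c hbc
    have hpi : (2 * Real.pi * Complex.I : ℂ) ≠ 0 := Complex.two_pi_I_ne_zero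
    -- The eight values of `l` in `hsq` pair up as `l x y - l y x`. Each pair gives `π * I * (2 * [y
    -- < x] - 1)`, and the four `-1` make up the `-2`.
    have : (2 * Real.pi * Complex.I : ℂ) * ((N a s(c, d) - N b s(c, d) - N c s(a, b) +
        N d s(a, b) + ((if d < a then 1 else 0) + (if a < c then 1 else 0) +
        (if b < d then 1 else 0) + (if c < b then 1 else 0) - 2 : ℤ) : ℤ) : ℂ) = 0 := by
      simp only [Int.cast_add, Int.cast_sub, Int.cast_ofNat]
      linear_combination hsq - i1 - i2 - i3 - i4
    exact_mod_cast (mul_eq_zero.1 this).resolve_left hpi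
  have htwo : (2 : ZMod 2) = 0 := rfl
  have hif : ∀ x y : V, x ≠ y → (if x < y then 1 else 0 : ZMod 2) =
      1 - (if y < x then 1 else 0 : ZMod 2) := by
    intro x y hxy
    rcases lt_or_gt_of_ne hxy with h | h <;> simp [h, h.not_gt]
  have key' : ∀ a b c d, G.Adj a b → G.Adj c d → a ≠ c → a ≠ d → b ≠ c → b ≠ d →
      g s(a, b) 0 = z a → g s(a, b) 1 = z b → g s(c, d) 0 = z c → g s(c, d) 1 = z d →
      (N a s(c, d) + N b s(c, d) + N c s(a, b) + N d s(a, b) : ZMod 2) =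
        (if c < a then 1 else 0) + (if d < a then 1 else 0) + (if c < b then 1 else 0) +
          (if d < b then 1 else 0) := by
    intro a b c d hab hcd hac had hbc hbd e1 e2 e3 e4
    have h := congrArg (Int.cast : ℤ → ZMod 2)
      (key a b c d hab hcd hac had hbc hbd e1 e2 e3 e4)
    push_cast at h
    linear_combination h - hif a c hac - hif b d hbd + (N b s(c, d) + N c s(a, b) -
      (if d < a then 1 else 0) - (if c < b then 1 else 0)) * htwo
  refine ⟨fun v e => N v e, fun a b c d hab hcd hac had hbc hbd => ?_⟩
  -- The formula mod 2 is symmetric in `a`, `b` and in `c`, `d`, so the direction in which an arc is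
  -- parametrised is irrelevant.
  rcases hends a b hab with ⟨e1, e2⟩ | ⟨e1, e2⟩ <;>
    rcases hends c d hcd with ⟨e3, e4⟩ | ⟨e3, e4⟩
  · exact key' a b c d hab hcd hac had hbc hbd e1 e2 e3 e4
  · rw [Sym2.eq_swap] at e3 e4
    have h := key' a b d c hab hcd.symm had hac hbd hbc e1 e2 e3 e4
    rw [Sym2.eq_swap (a := d)] at h
    linear_combination h
  · rw [Sym2.eq_swap] at e1 e2
    have h := key' b a c d hab.symm hcd hbc hbd hac had e1 e2 e3 e4
    rw [Sym2.eq_swap (a := b)] at h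
    linear_combination h
  · rw [Sym2.eq_swap] at e1 e2 e3 e4
    have h := key' b a d c hab.symm hcd.symm hbd hbc had hac e1 e2 e3 e4
    rw [Sym2.eq_swap (a := b), Sym2.eq_swap (a := d)] at h
    linear_combination h

end SimpleGraph

/-- The vertices `v` and the edges `e` for which the number `N v e` of
`SimpleGraph.IsPlanar.exists_parity` contributes to the number of crossings of a pair of edges. -/
def vertexEdgePairs (S : List ((ℕ × ℕ) × (ℕ × ℕ))) : List (ℕ × (ℕ × ℕ)) :=
  S.flatMap fun q => [(q.1.1, q.2), (q.1.2, q.2), (q.2.1, q.1), (q.2.2, q.1)]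

/-- A van Kampen obstruction: a list of pairs of independent edges `ab`, `cd` of a graph, with
an odd total number of crossings in the convex drawing, that is a mod 2 cycle. -/
theorem SimpleGraph.not_isPlanar_of_list {V : Type*} [LinearOrder V] {G : SimpleGraph V}
    (m : ℕ) (f : ℕ → V) (hf : StrictMonoOn f (Set.Iio m)) (S : List ((ℕ × ℕ) × (ℕ × ℕ)))
    (hadj : ∀ q ∈ S, G.Adj (f q.1.1) (f q.1.2) ∧ G.Adj (f q.2.1) (f q.2.2))
    (hS : ∀ q ∈ S, (q.1.1 < m ∧ q.1.2 < m ∧ q.2.1 < m ∧ q.2.2 < m) ∧ q.1.1 ≠ q.2.1 ∧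
      q.1.1 ≠ q.2.2 ∧ q.1.2 ≠ q.2.1 ∧ q.1.2 ≠ q.2.2)
    (hodd : (S.map fun q => (if q.2.1 < q.1.1 then 1 else 0) + (if q.2.2 < q.1.1 then 1 else 0) +
      (if q.2.1 < q.1.2 then 1 else 0) + (if q.2.2 < q.1.2 then 1 else 0)).sum % 2 = 1)
    (heven : ∀ x ∈ vertexEdgePairs S, (vertexEdgePairs S).count x % 2 = 0) :
    ¬ G.IsPlanar := by
  intro hG
  obtain ⟨N, hN⟩ := hG.exists_parity
  let M : ℕ × (ℕ × ℕ) → ZMod 2 := fun x => N (f x.1) s(f x.2.1, f x.2.2)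
  -- Every unknown occurs an even number of times in the sum of all equations, so the left-hand
  -- sides cancel, while the right-hand sides add up to 1.
  have h0 : ((vertexEdgePairs S).map M).sum = 0 := by
    rw [Finset.sum_list_map_count]
    refine Finset.sum_eq_zero fun x hx => ?_
    obtain ⟨k, hk⟩ := Nat.even_iff.2 (heven x (List.mem_toFinset.1 hx))
    convert_to (k + k) • M x = 0
    · rw [← hk]; congr!
    rw [add_nsmul, CharTwo.add_self_eq_zero]
  have h1 : ((vertexEdgePairs S).map M).sum = 1 := by
    have hodd' := (ZMod.natCast_eq_natCast_iff' _ 1 2).2 hodd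
    rw [Nat.cast_one] at hodd'
    rw [← hodd', vertexEdgePairs, List.map_flatMap, List.flatMap_def, List.sum_flatten,
      List.map_map, Nat.cast_list_sum, List.map_map]
    congr 1
    refine List.map_congr_left fun q hq => ?_
    obtain ⟨a1, a2⟩ := hadj q hq
    obtain ⟨⟨b1, b2, b3, b4⟩, n1, n2, n3, n4⟩ := hS q hq
    have h := hN _ _ _ _ a1 a2 (hf.injOn.ne b1 b3 n1) (hf.injOn.ne b1 b4 n2)
      (hf.injOn.ne b2 b3 n3) (hf.injOn.ne b2 b4 n4)
    simp only [hf.lt_iff_lt b3 b1, hf.lt_iff_lt b4 b1, hf.lt_iff_lt b3 b2,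
      hf.lt_iff_lt b4 b2] at h
    simp only [Function.comp, List.map_cons, List.map_nil, List.sum_cons, List.sum_nil, M]
    push_cast
    rw [← h]
    ring
  exact zero_ne_one (h0.symm.trans h1)

/-! ### The 4-cube is not planar -/

/-- A subdivision of the complete bipartite graph on `3 + 3` vertices in the 4-dimensional
hypercube, whose vertices are encoded by the numbers below 16: the `j`-th path of the `i`-th list
joins the `i`-th vertex of one side and the `j`-th vertex of the other side. -/
def hypercubePaths : List (List (List ℕ)) :=
  [[[10, 14], [10, 8], [10, 11, 15]],
    [[6, 14], [6, 4, 0, 8], [6, 7, 15]],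
    [[12, 14], [12, 8], [12, 13, 15]]]

/-- The pairs of edges that lie on paths of `hypercubePaths` without a common end. -/
def hypercubePairs : List ((ℕ × ℕ) × (ℕ × ℕ)) :=
  [(0, 1), (0, 2), (1, 2)].flatMap fun i : ℕ × ℕ =>
    [(0, 1), (0, 2), (1, 0), (1, 2), (2, 0), (2, 1)].flatMap fun j : ℕ × ℕ =>
      let p := (hypercubePaths[i.1]!)[j.1]!
      let q := (hypercubePaths[i.2]!)[j.2]!
      (p.zip p.tail).product (q.zip q.tail)

/-- The parity condition `heven` holds since an inner vertex of a path lies on two of its edges, and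
a branch vertex that is not an end of a given path starts exactly two paths sharing no end with it.
Encoding words by their bits provides the linear order and makes all conditions decidable. -/
theorem not_isPlanar_hypercubeGraph_four : ¬ (hypercubeGraph 4).IsPlanar := by
  let φ : Fin 16 → Fin 4 → Bool := fun x i => x.val.testBit i
  have hφ : Function.Injective φ := by decide +kernel
  intro h
  have h' : ((hypercubeGraph 4).comap φ).IsPlanar :=
    h.of_isContained ⟨⟨⟨φ, fun h => h⟩, hφ⟩⟩
  have hφ' : ∀ x < 16, φ (Fin.ofNat 16 x) = fun i : Fin 4 => x.testBit i := by
    intro x hx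
    simp only [φ, Fin.ofNat, Nat.mod_eq_of_lt hx]
  have hlt : ∀ q ∈ hypercubePairs,
      (q.1.1 < 16 ∧ q.1.2 < 16 ∧ q.2.1 < 16 ∧ q.2.2 < 16) ∧ q.1.1 ≠ q.2.1 ∧
      q.1.1 ≠ q.2.2 ∧ q.1.2 ≠ q.2.1 ∧ q.1.2 ≠ q.2.2 := by
    decide +kernel
  have hdist : ∀ q ∈ hypercubePairs,
      hammingDist (fun i : Fin 4 => q.1.1.testBit i) (fun i => q.1.2.testBit i) = 1 ∧
      hammingDist (fun i : Fin 4 => q.2.1.testBit i) (fun i => q.2.2.testBit i) = 1 := by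
    decide +kernel
  refine SimpleGraph.not_isPlanar_of_list 16 (Fin.ofNat 16) ?_ hypercubePairs ?_ hlt ?_ ?_ h'
  · intro x hx y hy hxy
    rw [Fin.lt_def, Fin.val_ofNat, Fin.val_ofNat, Nat.mod_eq_of_lt hx, Nat.mod_eq_of_lt hy]
    exact hxy
  · intro q hq
    obtain ⟨⟨b1, b2, b3, b4⟩, -⟩ := hlt q hq
    change hammingDist _ _ = 1 ∧ hammingDist _ _ = 1
    rw [hφ' _ b1, hφ' _ b2, hφ' _ b3, hφ' _ b4]
    exact hdist q hq
  · decide +kernel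
  · decide +kernel

/-! ### Positions relative to an apex -/

namespace FlipGraph

variable {n : ℕ}

/-- The position of the vertex `x` when the vertices are counted starting from `v`. -/
def pos (v x : Fin (n + 2)) : ℕ := (x - v).val

/-- The vertex at position `k` when the vertices are counted starting from `v`. -/
def vertexAt (v : Fin (n + 2)) (k : ℕ) : Fin (n + 2) := v + Fin.ofNat (n + 2) k

theorem pos_le (v x : Fin (n + 2)) : pos v x ≤ n + 1 := Nat.le_of_lt_succ (x - v).isLt

theorem pos_injective (v : Fin (n + 2)) : Function.Injective (pos v) :=
  fun _ _ h => sub_left_injective (Fin.val_injective h)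

theorem pos_vertexAt (v : Fin (n + 2)) {k : ℕ} (hk : k ≤ n + 1) : pos v (vertexAt v k) = k := by
  rw [pos, vertexAt, add_sub_cancel_left, Fin.val_ofNat, Nat.mod_eq_of_lt (by omega)]

theorem pos_self (v : Fin (n + 2)) : pos v v = 0 := by simp [pos]

theorem pos_eq_iff {v x : Fin (n + 2)} {k : ℕ} (hk : k ≤ n + 1) :
    pos v x = k ↔ x = vertexAt v k := by
  rw [← (pos_injective v).eq_iff, pos_vertexAt v hk]

theorem vertexAt_zero (v : Fin (n + 2)) : vertexAt v 0 = v :=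
  ((pos_eq_iff (by omega)).1 (pos_self v)).symm

/-- The cyclic order is invariant under rotation, so any vertex may serve as origin. This turns
crossing questions into linear arithmetic. -/
theorem sbtw_iff_pos (v a b c : Fin (n + 2)) :
    sbtw a b c ↔ pos v a < pos v b ∧ pos v b < pos v c ∨ pos v b < pos v c ∧ pos v c < pos v a ∨
      pos v c < pos v a ∧ pos v a < pos v b := by
  have h : ∀ x, v.val ≤ x.val ∧ pos v x = x.val - v.val ∨
      x.val < v.val ∧ pos v x = n + 2 + x.val - v.val := by
    intro x
    have hx := x.isLt
    have hv := v.isLt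
    rcases le_or_gt v x with h | h
    · exact .inl ⟨h, Fin.sub_val_of_le h⟩
    · refine .inr ⟨h, ?_⟩
      rw [pos, Fin.coe_sub_iff_lt.2 h]
  have ha := h a
  have hb := h b
  have hc := h c
  have la := a.isLt
  have lb := b.isLt
  have lc := c.isLt
  rw [Fin.sbtw_iff]
  simp only [Fin.lt_def]
  omega

theorem eq_add_one_iff_pos (v a b : Fin (n + 2)) :
    b = a + 1 ↔ pos v b = pos v a + 1 ∨ pos v a = n + 1 ∧ pos v b = 0 := by
  have h : pos v (a + 1) = if pos v a = n + 1 then 0 else pos v a + 1 := by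
    rw [pos, pos, add_sub_right_comm, Fin.val_add_one]
    simp only [Fin.ext_iff, Fin.val_last]
  rw [← (pos_injective v).eq_iff, h]
  have := pos_le v a
  have := pos_le v b
  split_ifs <;> omega

theorem isSide_iff_pos (v a b : Fin (n + 2)) :
    IsSide s(a, b) ↔ (pos v b = pos v a + 1 ∨ pos v a = n + 1 ∧ pos v b = 0) ∨
      (pos v a = pos v b + 1 ∨ pos v b = n + 1 ∧ pos v a = 0) := by
  rw [← eq_add_one_iff_pos, ← eq_add_one_iff_pos]
  constructor
  · rintro ⟨i, hi⟩
    rcases Sym2.eq_iff.1 hi with ⟨rfl, rfl⟩ | ⟨rfl, rfl⟩ <;> simp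
  · rintro (rfl | rfl)
    · exact ⟨a, rfl⟩
    · exact ⟨b, Sym2.eq_swap⟩

/-! ### Flipped fans as triangulations -/

/-- The diagonals, with the smaller position first, of the triangulation that is obtained from the
fan triangulation with apex at position `0` by flipping the diagonals to the positions in `F`. -/
def FanDiag (n : ℕ) (F : Finset ℕ) (i j : ℕ) : Prop :=
  (i = 0 ∧ 2 ≤ j ∧ j ≤ n ∧ j ∉ F) ∨ (i + 1 ∈ F ∧ j = i + 2)

/-- `F` consists of positions of diagonals of the fan that can be flipped independently. -/
def IsFlippable (n : ℕ) (F : Finset ℕ) : Prop :=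
  ∀ m ∈ F, 2 ≤ m ∧ m ≤ n ∧ m + 1 ∉ F

open Classical in
/-- The diagonals of the flipped fan with apex `v`. -/
noncomputable def fanDiagonals (v : Fin (n + 2)) (F : Finset ℕ) : Finset (Sym2 (Fin (n + 2))) :=
  Finset.univ.filter fun e => ∃ a b, e = s(a, b) ∧ FanDiag n F (pos v a) (pos v b)

theorem mem_fanDiagonals {v : Fin (n + 2)} {F : Finset ℕ} {e : Sym2 (Fin (n + 2))} :
    e ∈ fanDiagonals v F ↔ ∃ a b, e = s(a, b) ∧ FanDiag n F (pos v a) (pos v b) := by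
  simp [fanDiagonals]

theorem mk_mem_fanDiagonals {v : Fin (n + 2)} {F : Finset ℕ} {a b : Fin (n + 2)} :
    s(a, b) ∈ fanDiagonals v F ↔
      FanDiag n F (pos v a) (pos v b) ∨ FanDiag n F (pos v b) (pos v a) := by
  rw [mem_fanDiagonals]
  constructor
  · rintro ⟨x, y, h, hD⟩
    rcases Sym2.eq_iff.1 h with ⟨rfl, rfl⟩ | ⟨rfl, rfl⟩
    · exact .inl hD
    · exact .inr hD
  · rintro (h | h)
    · exact ⟨a, b, rfl, h⟩
    · exact ⟨b, a, Sym2.eq_swap, h⟩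

theorem FanDiag.lt {F : Finset ℕ} {i j : ℕ} (h : FanDiag n F i j) : i < j := by
  rcases h with h | h <;> omega

/-- A short diagonal from `m - 1` to `m + 1` separates only position `m` from the apex, and that fan
diagonal has been removed; two short diagonals alternate only if their middle positions are
consecutive. -/
theorem FanDiag.not_alternate {F : Finset ℕ} (hF : IsFlippable n F) {i j i' j' : ℕ}
    (h : FanDiag n F i j) (h' : FanDiag n F i' j') (h1 : i < i') (h2 : i' < j) (h3 : j < j') :
    False := by
  rcases h with ⟨rfl, -, -, hj⟩ | ⟨hm, rfl⟩ <;> rcases h' with ⟨rfl, -⟩ | ⟨hm', rfl⟩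
  · omega
  · obtain rfl : j = i' + 1 := by omega
    exact hj hm'
  · omega
  · obtain rfl : i' = i + 1 := by omega
    exact (hF _ hm).2.2 hm'

/-- Two segments that alternate in position cross. -/
theorem crosses_of_pos_lt (v : Fin (n + 2)) {a b c d : Fin (n + 2)} (h1 : pos v a < pos v b)
    (h2 : pos v b < pos v c) (h3 : pos v c < pos v d) : Crosses s(a, c) s(b, d) :=
  ⟨a, b, c, d, rfl, rfl, (sbtw_iff_pos v _ _ _).2 (by omega), (sbtw_iff_pos v _ _ _).2 (by omega)⟩

theorem crosses_symm {e e' : Sym2 (Fin (n + 2))} (h : Crosses e e') : Crosses e' e := by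
  obtain ⟨a, b, c, d, rfl, rfl, h1, h2⟩ := h
  refine ⟨b, c, d, a, rfl, Sym2.eq_swap, ?_, ?_⟩ <;> rw [sbtw_iff_pos 0] at * <;> omega

/-- The fan triangulation with apex `v`, with the diagonals at the positions in `F` flipped. -/
noncomputable def fan (v : Fin (n + 2)) (F : Finset ℕ) (hF : IsFlippable n F) :
    Triangulation n where
  diagonals := fanDiagonals v F
  isDiagonal e he := by
    obtain ⟨a, b, rfl, h⟩ := mem_fanDiagonals.1 he
    refine ⟨?_, ?_⟩
    · rw [Sym2.mk_isDiag_iff]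
      rintro rfl
      exact lt_irrefl _ h.lt
    · rw [isSide_iff_pos v]
      rcases h with h | ⟨h, h'⟩
      · omega
      · have := hF _ h
        omega
  not_crosses e he e' he' := by
    rintro ⟨a, b, c, d, rfl, rfl, h1, h2⟩
    rw [sbtw_iff_pos v] at h1 h2
    rw [mk_mem_fanDiagonals] at he he'
    rcases he with he | he <;> rcases he' with he' | he' <;> have l1 := he.lt <;> have l2 := he'.lt
    · exact he.not_alternate hF he' (by omega) (by omega) (by omega)
    · by_cases h : pos v a < pos v d
      · exact he.not_alternate hF he' (by omega) (by omega) (by omega)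
      · exact he'.not_alternate hF he (by omega) (by omega) (by omega)
    · by_cases h : pos v c < pos v b
      · exact he.not_alternate hF he' (by omega) (by omega) (by omega)
      · exact he'.not_alternate hF he (by omega) (by omega) (by omega)
    · by_cases h : pos v c < pos v d
      · exact he.not_alternate hF he' (by omega) (by omega) (by omega)
      · exact he'.not_alternate hF he (by omega) (by omega) (by omega)
  maximal e he hc := by
    have key : ∀ a b, pos v a < pos v b → ¬ IsSide s(a, b) →
        (∀ e' ∈ fanDiagonals v F, ¬ Crosses s(a, b) e') → FanDiag n F (pos v a) (pos v b) := by
      intro a b hab hs hc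
      have hb := pos_le v b
      rw [isSide_iff_pos v] at hs
      have hcr : ∀ i j, FanDiag n F i j → j ≤ n + 1 →
          ¬ (i < pos v a ∧ pos v a < j ∧ j < pos v b) ∧
          ¬ (pos v a < i ∧ i < pos v b ∧ pos v b < j) := by
        intro i j hij hj
        have hlt := hij.lt
        have hi' := pos_vertexAt v (k := i) (by omega)
        have hj' := pos_vertexAt v (k := j) (by omega)
        have hmem : s(vertexAt v i, vertexAt v j) ∈ fanDiagonals v F :=
          mk_mem_fanDiagonals.2 (.inl (by rwa [hi', hj']))
        exact ⟨fun h => hc _ hmem (crosses_symm (crosses_of_pos_lt v (by omega) (by omega)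
          (by omega))), fun h => hc _ hmem (crosses_of_pos_lt v (by omega) (by omega)
          (by omega))⟩
      -- From the apex, only the short diagonal over `b` could stand in the way. Otherwise every
      -- position strictly between `a` and `b` must be in `F`, or its fan diagonal would cross; as
      -- `F` has no consecutive elements, there is just one such position.
      by_cases h0 : pos v a = 0
      · refine .inl ⟨h0, by omega, by omega, fun hF' => ?_⟩
        exact (hcr (pos v b - 1) (pos v b + 1) (.inr ⟨by
          rwa [Nat.sub_add_cancel (by omega)], by omega⟩) (by omega)).2 (by omega)
      · have h1 : ∀ m, pos v a < m → m < pos v b → m ∈ F := by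
          intro m h1 h2
          by_contra hm
          exact (hcr 0 m (.inl ⟨rfl, by omega, by omega, hm⟩) (by omega)).1 (by omega)
        have h2 := h1 (pos v a + 1) (by omega) (by omega)
        refine .inr ⟨h2, ?_⟩
        by_contra h3
        exact (hF _ h2).2.2 (h1 _ (by omega) (by omega))
    induction e with
    | _ a b =>
      rw [mk_mem_fanDiagonals]
      have hne : pos v a ≠ pos v b := fun h => he.1 (Sym2.mk_isDiag_iff.2 (pos_injective v h))
      rcases lt_or_gt_of_ne hne with h | h
      · exact .inl (key a b h he.2 hc)
      · rw [Sym2.eq_swap] at he hc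
        exact .inr (key b a h he.2 hc)

/-! ### Triangles and colours of flipped fans -/

/-- The vertices at the positions `i` and `j` are joined by a boundary segment or a diagonal of the
flipped fan. -/
def FanAdj (n : ℕ) (F : Finset ℕ) (i j : ℕ) : Prop :=
  ((j = i + 1 ∨ i = n + 1 ∧ j = 0) ∨ (i = j + 1 ∨ j = n + 1 ∧ i = 0)) ∨
    (FanDiag n F i j ∨ FanDiag n F j i)

theorem isFace_fan {v : Fin (n + 2)} {F : Finset ℕ} {hF : IsFlippable n F}
    {f : Finset (Fin (n + 2))} : (fan v F hF).IsFace f ↔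
      f.card = 3 ∧ ∀ a ∈ f, ∀ b ∈ f, a ≠ b → FanAdj n F (pos v a) (pos v b) := by
  simp only [Triangulation.IsFace, isSide_iff_pos v, FanAdj, ← mk_mem_fanDiagonals]
  rfl

/-- The set `f` lies in the quadrilateral whose diagonal to position `m` of the fan can be
flipped. -/
def InQuad (v : Fin (n + 2)) (m : ℕ) (f : Finset (Fin (n + 2))) : Prop :=
  ∀ x ∈ f, pos v x = 0 ∨ pos v x = m - 1 ∨ pos v x = m ∨ pos v x = m + 1

open Classical in
/-- The flipped fan where the triangles have colour `i` before the flips. -/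
noncomputable def colouredFan (v : Fin (n + 2)) (i : Bool) (F : Finset ℕ) (hF : IsFlippable n F) :
    ColouredTriangulation n where
  toTriangulation := fan v F hF
  colour f := if (fan v F hF).IsFace f then some (i ^^ decide (∃ m ∈ F, InQuad v m f)) else none
  colour_isSome_iff f := by split_ifs with h <;> simp [h]

/-- A triple in a set of four omits exactly one element. This identifies the triangles that a flip
may change. -/
theorem eq_of_inQuad {v : Fin (n + 2)} {m : ℕ} (h2 : 2 ≤ m) (hm : m ≤ n)
    {f : Finset (Fin (n + 2))} (hf : f.card = 3) (hq : InQuad v m f) :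
    f = {v, vertexAt v (m - 1), vertexAt v m} ∨ f = {v, vertexAt v m, vertexAt v (m + 1)} ∨
      f = {v, vertexAt v (m - 1), vertexAt v (m + 1)} ∨
      f = {vertexAt v (m - 1), vertexAt v m, vertexAt v (m + 1)} := by
  have hne : ∀ i j, i ≤ n + 1 → j ≤ n + 1 → i ≠ j → vertexAt v i ≠ vertexAt v j := by
    intro i j hi hj hij h
    rw [← pos_eq_iff hj, pos_vertexAt v hi] at h
    exact hij h
  have h01 := hne 0 (m - 1) (by omega) (by omega) (by omega)
  have h02 := hne 0 m (by omega) (by omega) (by omega)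
  have h03 := hne 0 (m + 1) (by omega) (by omega) (by omega)
  have h12 := hne (m - 1) m (by omega) (by omega) (by omega)
  have h13 := hne (m - 1) (m + 1) (by omega) (by omega) (by omega)
  have h23 := hne m (m + 1) (by omega) (by omega) (by omega)
  rw [vertexAt_zero] at h01 h02 h03
  have hsub : ∀ x ∈ f, x = v ∨ x = vertexAt v (m - 1) ∨ x = vertexAt v m ∨
      x = vertexAt v (m + 1) := by
    intro x hx
    have := hq x hx
    rwa [pos_eq_iff (by omega), pos_eq_iff (by omega), pos_eq_iff (by omega),
      pos_eq_iff (by omega), vertexAt_zero] at this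
  generalize vertexAt v (m - 1) = x1 at *
  generalize vertexAt v m = x2 at *
  generalize vertexAt v (m + 1) = x3 at *
  have hss : f ⊆ {v, x1, x2, x3} := fun x hx => by simpa using hsub x hx
  have hcard : ({v, x1, x2, x3} : Finset (Fin (n + 2))).card = 4 := by
    simp [Finset.card_insert_of_notMem, h01, h02, h03, h12, h13, h23]
  obtain ⟨w, hw, hwf⟩ := Finset.exists_eq_insert_iff.2 ⟨hss, by rw [hf, hcard]⟩
  have hfw : f = ({v, x1, x2, x3} : Finset (Fin (n + 2))).erase w := by
    rw [← hwf, Finset.erase_insert hw]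
  have hwmem : w ∈ ({v, x1, x2, x3} : Finset (Fin (n + 2))) := hwf ▸ Finset.mem_insert_self w f
  simp only [Finset.mem_insert, Finset.mem_singleton] at hwmem
  rcases hwmem with rfl | rfl | rfl | rfl
  · refine .inr (.inr (.inr ?_)); rw [hfw]; ext y; simp; grind
  · refine .inr (.inl ?_); rw [hfw]; ext y; simp; grind
  · refine .inr (.inr (.inl ?_)); rw [hfw]; ext y; simp; grind
  · refine .inl ?_; rw [hfw]; ext y; simp; grind

end FlipGraph

namespace FlipGraph

variable {n : ℕ}

theorem FanAdj.symm {F : Finset ℕ} {i j : ℕ} (h : FanAdj n F i j) : FanAdj n F j i := by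
  unfold FanAdj at *; tauto

theorem isFace_fan_of_pos {v : Fin (n + 2)} {F : Finset ℕ} {hF : IsFlippable n F} {j k l : ℕ}
    (hjk : j < k) (hkl : k < l) (hl : l ≤ n + 1)
    (h1 : FanAdj n F j k) (h2 : FanAdj n F k l) (h3 : FanAdj n F j l) :
    (fan v F hF).IsFace {vertexAt v j, vertexAt v k, vertexAt v l} := by
  have pj := pos_vertexAt v (k := j) (by omega)
  have pk := pos_vertexAt v (k := k) (by omega)
  have pl := pos_vertexAt v (k := l) (by omega)
  rw [isFace_fan]
  refine ⟨Finset.card_eq_three.2 ⟨_, _, _, fun h => ?_, fun h => ?_, fun h => ?_, rfl⟩, ?_⟩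
  · rw [h] at pj; omega
  · rw [h] at pj; omega
  · rw [h] at pk; omega
  · simp only [Finset.mem_insert, Finset.mem_singleton]
    rintro a (rfl | rfl | rfl) b (rfl | rfl | rfl) hab
    · exact absurd rfl hab
    · rwa [pj, pk]
    · rwa [pj, pl]
    · rw [pj, pk]; exact h1.symm
    · exact absurd rfl hab
    · rwa [pk, pl]
    · rw [pj, pl]; exact h3.symm
    · rw [pk, pl]; exact h2.symm
    · exact absurd rfl hab

section Colour

variable {v : Fin (n + 2)} {i : Bool} {F : Finset ℕ} {hF : IsFlippable n F}
  {f : Finset (Fin (n + 2))}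

open Classical in
theorem colouredFan_colour_of_forall (hf : (fan v F hF).IsFace f)
    (h : ∀ m ∈ F, ¬ InQuad v m f) : (colouredFan v i F hF).colour f = some i := by
  have h' : ¬ ∃ m ∈ F, InQuad v m f := fun ⟨m, hm, hq⟩ => h m hm hq
  simp only [colouredFan, if_pos hf, decide_eq_false h', Bool.xor_false]

open Classical in
theorem colouredFan_colour_of_exists (hf : (fan v F hF).IsFace f)
    (h : ∃ m ∈ F, InQuad v m f) : (colouredFan v i F hF).colour f = some (!i) := by
  simp only [colouredFan, if_pos hf, decide_eq_true h, Bool.xor_true]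

theorem colouredFan_colour_of_not_isFace (hf : ¬ (fan v F hF).IsFace f) :
    (colouredFan v i F hF).colour f = none := if_neg hf

end Colour

/-! ### The effect of one more flip -/

section Flip

variable {F : Finset ℕ} {m : ℕ} (hF : IsFlippable n F) (hF' : IsFlippable n (insert m F))

include hF hF'

omit hF in
theorem notMem_of_isFlippable_insert : 2 ≤ m ∧ m ≤ n ∧ m + 1 ∉ F ∧ m - 1 ∉ F := by
  obtain ⟨h2, hn, h1⟩ := hF' m (Finset.mem_insert_self m F)
  refine ⟨h2, hn, fun h => h1 (Finset.mem_insert_of_mem h), fun h => ?_⟩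
  have := (hF' (m - 1) (Finset.mem_insert_of_mem h)).2.2
  rw [Nat.sub_add_cancel (by omega)] at this
  exact this (Finset.mem_insert_self m F)

theorem fanDiag_insert {i j : ℕ} : FanDiag n (insert m F) i j ↔
    FanDiag n F i j ∧ ¬ (i = 0 ∧ j = m) ∨ i = m - 1 ∧ j = m + 1 := by
  obtain ⟨h2, hn, h3, h4⟩ := notMem_of_isFlippable_insert hF'
  unfold FanDiag
  simp only [Finset.mem_insert, not_or]
  constructor
  · rintro (⟨h, h5, h6, h7, h8⟩ | ⟨h | h, h5⟩)
    · exact .inl ⟨.inl ⟨h, h5, h6, h8⟩, fun h => h7 h.2⟩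
    · exact .inr (by omega)
    · have := hF _ h
      exact .inl ⟨.inr ⟨h, h5⟩, by omega⟩
  · rintro (⟨⟨h, h5, h6, h7⟩ | ⟨h, h5⟩, h8⟩ | ⟨h, h5⟩)
    · exact .inl ⟨h, h5, h6, fun h9 => h8 ⟨h, h9⟩, h7⟩
    · exact .inr ⟨.inr h, h5⟩
    · exact .inr ⟨.inl (by omega), by omega⟩

/-- Edges that are lost in the flip at position `m` join the positions `0` and `m`. -/
theorem FanAdj.insert_or {i j : ℕ} (h : FanAdj n F i j) :
    FanAdj n (insert m F) i j ∨ (i = 0 ∧ j = m ∨ j = 0 ∧ i = m) := by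
  rcases h with h | h | h
  · exact .inl (.inl h)
  · by_cases h' : i = 0 ∧ j = m
    · exact .inr (.inl h')
    · exact .inl (.inr (.inl ((fanDiag_insert hF hF').2 (.inl ⟨h, h'⟩))))
  · by_cases h' : j = 0 ∧ i = m
    · exact .inr (.inr h')
    · exact .inl (.inr (.inr ((fanDiag_insert hF hF').2 (.inl ⟨h, h'⟩))))

/-- Edges that are created in the flip at position `m` join the positions `m - 1` and `m + 1`. -/
theorem FanAdj.of_insert {i j : ℕ} (h : FanAdj n (insert m F) i j) :
    FanAdj n F i j ∨ (i = m - 1 ∧ j = m + 1 ∨ j = m - 1 ∧ i = m + 1) := by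
  rcases h with h | h | h
  · exact .inl (.inl h)
  · exact ((fanDiag_insert hF hF').1 h).imp (fun h => .inr (.inl h.1)) .inl
  · exact ((fanDiag_insert hF hF').1 h).imp (fun h => .inr (.inr h.1)) .inr

/-- As `m - 1` and `m + 1` are not in `F`, no short diagonal ends at `m`, whose only neighbours are
therefore 0, `m - 1` and `m + 1`. -/
theorem FanAdj.eq_of_adj_of_adj (hm : m ∉ F) {j : ℕ} (h0 : FanAdj n F 0 j) (h : FanAdj n F m j) :
    j = m - 1 ∨ j = m + 1 := by
  have := notMem_of_isFlippable_insert hF'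
  have := fun x (hx : x ∈ F) => hF x hx
  unfold FanAdj FanDiag at *
  grind

theorem FanAdj.eq_of_insert_adj_of_adj {j : ℕ} (h0 : FanAdj n (insert m F) (m - 1) j)
    (h : FanAdj n (insert m F) (m + 1) j) : j = 0 ∨ j = m := by
  have := notMem_of_isFlippable_insert hF'
  have := fun x (hx : x ∈ F) => hF x hx
  unfold FanAdj FanDiag at *
  simp only [Finset.mem_insert, not_or] at h h0
  grind

variable {v : Fin (n + 2)} {f : Finset (Fin (n + 2))}

/-- A triangle using the lost edge from 0 to `m` has its third vertex at `m - 1` or `m + 1`, so it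
would lie in the quadrilateral. -/
theorem isFace_insert_of_not_inQuad (hm : m ∉ F) (hq : ¬ InQuad v m f)
    (h : (fan v F hF).IsFace f) :
    (fan v (insert m F) hF').IsFace f := by
  rw [isFace_fan] at h ⊢
  refine ⟨h.1, fun a ha b hb hab => ?_⟩
  rcases (h.2 a ha b hb hab).insert_or hF hF' with h' | h'
  · exact h'
  refine absurd (fun x hx => ?_) hq
  by_cases hxa : x = a
  · subst hxa; omega
  by_cases hxb : x = b
  · subst hxb; omega
  have h1 := h.2 a ha x hx (Ne.symm hxa)
  have h2 := h.2 b hb x hx (Ne.symm hxb)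
  rcases h' with ⟨e1, e2⟩ | ⟨e1, e2⟩ 
  · have := FanAdj.eq_of_adj_of_adj hF hF' hm (e1 ▸ h1) (e2 ▸ h2)
    omega
  · have := FanAdj.eq_of_adj_of_adj hF hF' hm (e1 ▸ h2) (e2 ▸ h1)
    omega

theorem isFace_of_insert_of_not_inQuad (hq : ¬ InQuad v m f)
    (h : (fan v (insert m F) hF').IsFace f) : (fan v F hF).IsFace f := by
  rw [isFace_fan] at h ⊢
  refine ⟨h.1, fun a ha b hb hab => ?_⟩
  rcases (h.2 a ha b hb hab).of_insert hF hF' with h' | h'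
  · exact h'
  refine absurd (fun x hx => ?_) hq
  by_cases hxa : x = a
  · subst hxa; omega
  by_cases hxb : x = b
  · subst hxb; omega
  have h1 := h.2 a ha x hx (Ne.symm hxa)
  have h2 := h.2 b hb x hx (Ne.symm hxb)
  rcases h' with ⟨e1, e2⟩ | ⟨e1, e2⟩ 
  · have := FanAdj.eq_of_insert_adj_of_adj hF hF' (e1 ▸ h1) (e2 ▸ h2)
    omega
  · have := FanAdj.eq_of_insert_adj_of_adj hF hF' (e1 ▸ h2) (e2 ▸ h1)
    omega

theorem fanDiagonals_insert : fanDiagonals v (insert m F) =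
    insert s(vertexAt v (m - 1), vertexAt v (m + 1))
      ((fanDiagonals v F).erase s(v, vertexAt v m)) := by
  obtain ⟨h2, hn, h3, h4⟩ := notMem_of_isFlippable_insert hF'
  have e0 := fun x => pos_eq_iff (v := v) (x := x) (k := 0) (by omega)
  have e1 := fun x => pos_eq_iff (v := v) (x := x) (k := m - 1) (by omega)
  have e2 := fun x => pos_eq_iff (v := v) (x := x) (k := m) (by omega)
  have e3 := fun x => pos_eq_iff (v := v) (x := x) (k := m + 1) (by omega)
  simp only [vertexAt_zero] at e0
  ext e
  induction e with
  | _ a b =>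
    simp only [Finset.mem_insert, Finset.mem_erase, Ne, Sym2.eq_iff, mk_mem_fanDiagonals, ← e0,
      ← e1, ← e2, ← e3, fanDiag_insert hF hF']
    have l1 : FanDiag n F (pos v a) (pos v b) → pos v a < pos v b := FanDiag.lt
    have l2 : FanDiag n F (pos v b) (pos v a) → pos v b < pos v a := FanDiag.lt
    by_cases d1 : FanDiag n F (pos v a) (pos v b) <;>
      by_cases d2 : FanDiag n F (pos v b) (pos v a) <;>
      simp only [d1, d2, true_and, false_and, or_false, false_or, or_self, and_true,
        and_false, false_imp_iff,
        forall_const] at l1 l2 ⊢ <;>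
      omega

/-- Since neither neighbour of `m` is in `F`, the two triangles at the diagonal to `m` lie in no
quadrilateral flipped before and still have colour `i`. A triangle other than the four involved lies
outside the quadrilateral at `m`, so it survives with its colour. -/
theorem isFlip_colouredFan (hm : m ∉ F) (i : Bool) :
    (colouredFan v i F hF).IsFlip (colouredFan v i (insert m F) hF') := by
  obtain ⟨h2, hn, h3, h4⟩ := notMem_of_isFlippable_insert hF'
  have p1 := pos_vertexAt v (k := m - 1) (by omega)
  have p2 := pos_vertexAt v (k := m) (by omega)
  have p3 := pos_vertexAt v (k := m + 1) (by omega)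
  have q1 : ∀ m' ∈ F, ¬ InQuad v m' {v, vertexAt v (m - 1), vertexAt v m} := by
    intro m' hm' hq
    have h5 := hq (vertexAt v (m - 1)) (by simp)
    have h6 := hq (vertexAt v m) (by simp)
    have := hF m' hm'
    rw [p1] at h5
    rw [p2] at h6
    have : m' ≠ m := fun h => hm (h ▸ hm')
    have : m' ≠ m - 1 := fun h => h4 (h ▸ hm')
    omega
  have q2 : ∀ m' ∈ F, ¬ InQuad v m' {v, vertexAt v m, vertexAt v (m + 1)} := by
    intro m' hm' hq
    have h5 := hq (vertexAt v (m + 1)) (by simp)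
    have h6 := hq (vertexAt v m) (by simp)
    have := hF m' hm'
    rw [p3] at h5
    rw [p2] at h6
    have : m' ≠ m := fun h => hm (h ▸ hm')
    have : m' ≠ m + 1 := fun h => h3 (h ▸ hm')
    omega
  have q3 : InQuad v m {v, vertexAt v (m - 1), vertexAt v (m + 1)} := by
    simp [InQuad, p1, p3, pos_self]
  have q4 : InQuad v m {vertexAt v (m - 1), vertexAt v m, vertexAt v (m + 1)} := by
    simp [InQuad, p1, p2, p3]
  have f1 : (fan v F hF).IsFace {v, vertexAt v (m - 1), vertexAt v m} := by
    have := isFace_fan_of_pos (v := v) (hF := hF) (j := 0) (k := m - 1) (l := m)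
      (by omega) (by omega) (by omega)
      (by unfold FanAdj FanDiag; grind) (by unfold FanAdj; omega)
      (by unfold FanAdj FanDiag; grind)
    rwa [vertexAt_zero] at this
  have f2 : (fan v F hF).IsFace {v, vertexAt v m, vertexAt v (m + 1)} := by
    have := isFace_fan_of_pos (v := v) (hF := hF) (j := 0) (k := m) (l := m + 1)
      (by omega) (by omega) (by omega)
      (by unfold FanAdj FanDiag; grind) (by unfold FanAdj; omega)
      (by unfold FanAdj FanDiag; grind)
    rwa [vertexAt_zero] at this
  have f3 : (fan v (insert m F) hF').IsFace {v, vertexAt v (m - 1), vertexAt v (m + 1)} := by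
    have := isFace_fan_of_pos (v := v) (hF := hF') (j := 0) (k := m - 1) (l := m + 1)
      (by omega) (by omega) (by omega)
      (by unfold FanAdj FanDiag; grind) (by unfold FanAdj FanDiag; grind)
      (by unfold FanAdj FanDiag; grind)
    rwa [vertexAt_zero] at this
  have f4 : (fan v (insert m F) hF').IsFace
      {vertexAt v (m - 1), vertexAt v m, vertexAt v (m + 1)} :=
    isFace_fan_of_pos (by omega) (by omega) (by omega)
      (by unfold FanAdj; omega) (by unfold FanAdj; omega) (by unfold FanAdj FanDiag; grind)
  refine ⟨v, vertexAt v (m - 1), vertexAt v m, vertexAt v (m + 1), i, ?_, ?_, ?_, ?_,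
    fanDiagonals_insert hF hF', ?_, ?_, ?_⟩
  · intro h
    rw [h, p3] at p1
    omega
  · change _ ∈ fanDiagonals v F
    rw [mk_mem_fanDiagonals, pos_self, p2]
    exact .inl (.inl ⟨rfl, h2, hn, hm⟩)
  · exact colouredFan_colour_of_forall f1 q1
  · exact colouredFan_colour_of_forall f2 q2
  · exact colouredFan_colour_of_exists f3 ⟨m, Finset.mem_insert_self _ _, q3⟩
  · exact colouredFan_colour_of_exists f4 ⟨m, Finset.mem_insert_self _ _, q4⟩
  · intro f g1 g2 g3 g4
    by_cases hq : InQuad v m f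
    · have hcard : f.card ≠ 3 := fun h => by
        rcases eq_of_inQuad h2 hn h hq with h | h | h | h <;> contradiction
      rw [colouredFan_colour_of_not_isFace fun h => hcard h.1,
        colouredFan_colour_of_not_isFace fun h => hcard h.1]
    by_cases hf : (fan v F hF).IsFace f
    · have hf' := isFace_insert_of_not_inQuad hF hF' hm hq hf
      by_cases he : ∃ m' ∈ F, InQuad v m' f
      · obtain ⟨m', hm', hq'⟩ := he
        rw [colouredFan_colour_of_exists hf ⟨m', hm', hq'⟩,
          colouredFan_colour_of_exists hf' ⟨m', Finset.mem_insert_of_mem hm', hq'⟩]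
      · have he' : ∀ m' ∈ F, ¬ InQuad v m' f := fun m' hm' hq' => he ⟨m', hm', hq'⟩
        rw [colouredFan_colour_of_forall hf he', colouredFan_colour_of_forall hf']
        exact fun m' hm' => (Finset.mem_insert.1 hm').elim (fun h => h ▸ hq) (he' m')
    · rw [colouredFan_colour_of_not_isFace hf, colouredFan_colour_of_not_isFace fun h => hf
        (isFace_of_insert_of_not_inQuad hF hF' hq h)]

end Flip

end FlipGraph

/-! ### Monochromatic fans and the hypercube -/

namespace FlipGraph

variable {n : ℕ}

theorem ColouredTriangulation.eq_of_diagonals_of_colour {X Y : ColouredTriangulation n}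
    (h : X.diagonals = Y.diagonals) (h' : X.colour = Y.colour) : X = Y := by
  obtain ⟨⟨D, _, _, _⟩, c, _⟩ := X
  obtain ⟨⟨D', _, _, _⟩, c', _⟩ := Y
  dsimp only at h h'
  subst h h'
  rfl

theorem isFlippable_empty : IsFlippable n ∅ := fun _ h => absurd h (Finset.notMem_empty _)

theorem isFan_fan_empty (v : Fin (n + 2)) : (fan v ∅ isFlippable_empty).IsFan := by
  refine ⟨v, fun e he => ?_⟩
  obtain ⟨a, b, rfl, h | h⟩ := mem_fanDiagonals.1 he
  · rw [pos_eq_iff (by omega), vertexAt_zero] at h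
    simp [h.1]
  · exact absurd h.1 (Finset.notMem_empty _)

theorem isMonochromatic_colouredFan_empty (v : Fin (n + 2)) (i : Bool) :
    (colouredFan v i ∅ isFlippable_empty).IsMonochromatic :=
  ⟨i, fun _ hf => colouredFan_colour_of_forall hf fun _ h => absurd h (Finset.notMem_empty _)⟩

/-- All diagonals at `v` are pairwise non-crossing, so maximality forces every one of them to be
present. -/
theorem Triangulation.IsFan.exists_diagonals_eq {T : Triangulation n} (hT : T.IsFan) :
    ∃ v, T.diagonals = (fan v ∅ isFlippable_empty).diagonals := by
  obtain ⟨v, hv⟩ := hT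
  refine ⟨v, ?_⟩
  have hsub : T.diagonals ⊆ (fan v ∅ isFlippable_empty).diagonals := by
    intro e he
    obtain ⟨b, rfl⟩ := Sym2.mem_iff_exists.1 (hv e he)
    obtain ⟨h1, h2⟩ := T.isDiagonal _ he
    rw [isSide_iff_pos v, pos_self] at h2
    have h0 : pos v b ≠ 0 := fun h => h1 (Sym2.mk_isDiag_iff.2
      (pos_injective v ((pos_self v).trans h.symm)))
    have hb := pos_le v b
    refine mk_mem_fanDiagonals.2 (.inl (.inl ⟨pos_self v, ?_, ?_, Finset.notMem_empty _⟩)) <;>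
    omega
  refine hsub.antisymm fun e he => T.maximal e ((fan v ∅ isFlippable_empty).isDiagonal e he) ?_
  exact fun e' he' => (fan v ∅ isFlippable_empty).not_crosses e he e' (hsub he')

theorem ColouredTriangulation.exists_eq_colouredFan {X : ColouredTriangulation n} (hX : X.IsFan)
    (hX' : X.IsMonochromatic) : ∃ v i, X = colouredFan v i ∅ isFlippable_empty := by
  obtain ⟨v, hv⟩ := hX.exists_diagonals_eq
  obtain ⟨i, hi⟩ := hX'
  refine ⟨v, i, eq_of_diagonals_of_colour hv (funext fun f => ?_)⟩
  have hface : X.IsFace f ↔ (fan v ∅ isFlippable_empty).IsFace f := by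
    simp only [Triangulation.IsFace, hv]
  by_cases hf : X.IsFace f
  · rw [hi f hf, colouredFan_colour_of_forall (hface.1 hf) fun _ h =>
      absurd h (Finset.notMem_empty _)]
  · rw [colouredFan_colour_of_not_isFace (mt hface.2 hf)]
    rw [← X.colour_isSome_iff] at hf
    simpa using hf

/-- The positions of the flipped diagonals at a vertex of the hypercube. -/
def flipPositions {k : ℕ} (x : Fin k → Bool) : Finset ℕ :=
  (Finset.univ.filter fun j => x j = true).image fun j => 2 * j.val + 2

theorem mem_flipPositions {k : ℕ} {x : Fin k → Bool} {m : ℕ} :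
    m ∈ flipPositions x ↔ ∃ j, x j = true ∧ 2 * j.val + 2 = m := by
  simp [flipPositions]

theorem mem_flipPositions_iff {k : ℕ} {x : Fin k → Bool} (j : Fin k) :
    2 * j.val + 2 ∈ flipPositions x ↔ x j = true := by
  rw [mem_flipPositions]
  refine ⟨fun ⟨j', h, h'⟩ => ?_, fun h => ⟨j, h, rfl⟩⟩
  rwa [← show j' = j from Fin.ext (by omega)]

theorem flipPositions_injective (k : ℕ) :
    Function.Injective (flipPositions : (Fin k → Bool) → Finset ℕ) := by
  intro x y h
  funext j
  rw [Bool.eq_iff_iff, ← mem_flipPositions_iff, h, mem_flipPositions_iff]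

/-- The positions are among 2, 4, …, `2 * k`: never consecutive, and at most `n` by `hk`. -/
theorem isFlippable_flipPositions {k : ℕ} (hk : 2 * k ≤ n) (x : Fin k → Bool) :
    IsFlippable n (flipPositions x) := by
  intro m hm
  obtain ⟨j, -, rfl⟩ := mem_flipPositions.1 hm
  refine ⟨by omega, by omega, fun h => ?_⟩
  obtain ⟨j', -, h⟩ := mem_flipPositions.1 h
  omega

theorem flipPositions_update {k : ℕ} (x : Fin k → Bool) (j : Fin k) :
    flipPositions (Function.update x j true) = insert (2 * j.val + 2) (flipPositions x) := by
  ext m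
  simp only [mem_flipPositions, Finset.mem_insert]
  constructor
  · rintro ⟨j', h, rfl⟩
    by_cases hj : j' = j
    · exact .inl (by rw [hj])
    · exact .inr ⟨j', by simpa [hj] using h, rfl⟩
  · rintro (rfl | ⟨j', h, rfl⟩)
    · exact ⟨j, by simp, rfl⟩
    · refine ⟨j', ?_, rfl⟩
      by_cases hj : j' = j
      · simp [hj]
      · simpa [hj] using h

/-- `F` can be read off as the set of positions whose fan diagonal is missing. -/
theorem eq_of_fanDiagonals_eq {v : Fin (n + 2)} {F F' : Finset ℕ} (hF : IsFlippable n F)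
    (hF' : IsFlippable n F') (h : fanDiagonals v F = fanDiagonals v F') : F = F' := by
  have key : ∀ F, IsFlippable n F → ∀ m, m ∈ F ↔ 2 ≤ m ∧ m ≤ n ∧
      s(v, vertexAt v m) ∉ fanDiagonals v F := by
    intro F hF m
    by_cases hm : 2 ≤ m ∧ m ≤ n
    · rw [mk_mem_fanDiagonals, pos_self, pos_vertexAt v (by omega)]
      have h1 : 0 + 1 ∉ F := fun h => by have := hF _ h; omega
      unfold FanDiag
      simp only [h1, hm.1, hm.2, false_and, or_false, true_and]
      constructor
      · intro h
        simp only [h, not_true, false_or]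
        omega
      · intro h
        by_contra hmF
        exact h (.inl hmF)
    · exact ⟨fun h => absurd ⟨(hF m h).1, (hF m h).2.1⟩ hm, fun h => absurd ⟨h.1, h.2.1⟩ hm⟩
  ext m
  rw [key F hF, key F' hF', h]

section Hypercube

variable (k : ℕ) (hk : 2 * k ≤ n) (v : Fin (n + 2)) (i : Bool)

/-- The coloured triangulation at a vertex of the hypercube. -/
noncomputable def hypercubeVertex (x : Fin k → Bool) : ColouredTriangulation n :=
  colouredFan v i (flipPositions x) (isFlippable_flipPositions hk x)

theorem hypercubeVertex_injective : Function.Injective (hypercubeVertex k hk v i) := by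
  intro x y h
  exact flipPositions_injective k (eq_of_fanDiagonals_eq (isFlippable_flipPositions hk x)
    (isFlippable_flipPositions hk y) (congrArg (fun X => X.diagonals) h))

theorem isFlip_hypercubeVertex (x : Fin k → Bool) (j : Fin k) (hj : x j = false) :
    (hypercubeVertex k hk v i x).IsFlip (hypercubeVertex k hk v i (Function.update x j true)) := by
  have hm : 2 * j.val + 2 ∉ flipPositions x := by simp [mem_flipPositions_iff, hj]
  have h := isFlippable_flipPositions hk (Function.update x j true)
  simp only [hypercubeVertex]
  simp only [flipPositions_update] at h ⊢
  exact isFlip_colouredFan (isFlippable_flipPositions hk x) h hm i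

theorem adj_hypercubeVertex_update (x : Fin k → Bool) (j : Fin k) (b : Bool) (hj : x j ≠ b) :
    (colouredFlipGraph n).Adj (hypercubeVertex k hk v i x)
      (hypercubeVertex k hk v i (Function.update x j b)) := by
  rw [colouredFlipGraph, SimpleGraph.fromRel_adj]
  refine ⟨fun h => hj ?_, ?_⟩
  · have := congrFun (hypercubeVertex_injective k hk v i h) j
    simpa using this
  · cases b
    · right
      -- Clearing a bit is the reverse of the flip that sets it, so the edge comes from the other
      -- direction of `fromRel`.
      have h := isFlip_hypercubeVertex k hk v i (Function.update x j false) j (by simp)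
      rwa [Function.update_idem, show Function.update x j true = x from
        Function.update_eq_self_iff.2
          (by simpa using Eq.symm (Bool.eq_true_of_not_eq_false hj))] at h
    · left
      exact isFlip_hypercubeVertex k hk v i x j (by simpa using hj)

theorem adj_hypercubeVertex {x y : Fin k → Bool} (h : (hypercubeGraph k).Adj x y) :
    (colouredFlipGraph n).Adj (hypercubeVertex k hk v i x) (hypercubeVertex k hk v i y) := by
  obtain ⟨j, hj⟩ := Finset.card_eq_one.1 (show (Finset.univ.filter fun j => x j ≠ y j).card = 1
    from h)
  have hj' : ∀ j', x j' ≠ y j' ↔ j' = j := fun j' => by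
    have := congrArg (j' ∈ ·) hj
    simpa using this
  have hy : y = Function.update x j (y j) := by
    rw [Function.eq_update_iff]
    exact ⟨rfl, fun j' hne => (not_not.1 (mt (hj' j').1 hne)).symm⟩
  rw [hy]
  exact adj_hypercubeVertex_update k hk v i x j _ ((hj' j).2 rfl)

/-- Induction on the number of ones: clearing one of them is an edge of the flip graph. -/
theorem reachable_hypercubeVertex (x : Fin k → Bool) :
    (colouredFlipGraph n).Reachable (hypercubeVertex k hk v i fun _ => false)
      (hypercubeVertex k hk v i x) := by
  induction hc : (Finset.univ.filter fun j => x j = true).card generalizing x with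
  | zero =>
    rw [Finset.card_eq_zero, Finset.filter_eq_empty_iff] at hc
    rw [show x = fun _ => false from funext fun j => by simpa using hc (Finset.mem_univ j)]
  | succ c ih =>
    obtain ⟨j, hj⟩ := Finset.card_pos.1 (by omega :
      0 < (Finset.univ.filter fun j => x j = true).card)
    have hj' : x j = true := by simpa using hj
    have hadj := adj_hypercubeVertex_update k hk v i x j false (by simp [hj'])
    refine (ih (Function.update x j false) ?_).trans hadj.symm.reachable
    have : (Finset.univ.filter fun j' => Function.update x j false j' = true) =
        (Finset.univ.filter fun j => x j = true).erase j := by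
      ext j'
      by_cases h : j' = j <;> simp [h]
    rw [this, Finset.card_erase_of_mem hj, hc, Nat.add_sub_cancel]

include hk in
theorem hypercubeGraph_isContained_component :
    hypercubeGraph k ⊑ ((colouredFlipGraph n).connectedComponentMk
      (colouredFan v i ∅ isFlippable_empty)).toSimpleGraph := by
  have h0 : hypercubeVertex k hk v i (fun _ => false) = colouredFan v i ∅ isFlippable_empty := by
    have : flipPositions (fun _ : Fin k => false) = ∅ := by simp [flipPositions]
    simp only [hypercubeVertex, this]
  rw [← h0]
  refine ⟨⟨⟨fun x => ⟨hypercubeVertex k hk v i x, ?_⟩, fun h => ?_⟩, fun x y h => ?_⟩⟩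
  · exact SimpleGraph.ConnectedComponent.sound (reachable_hypercubeVertex k hk v i x).symm
  · exact adj_hypercubeVertex k hk v i h
  · exact hypercubeVertex_injective k hk v i (congrArg Subtype.val h)

end Hypercube

end FlipGraph

/-- For `n ≥ 8`, monochromatic fan triangulations of the polygon with `n + 2` vertices exist, and
for each of them its connected component in the 2-coloured flip graph contains a 4-dimensional
hypercube and is not planar; the 4-dimensional hypercube itself is not planar. -/
theorem corollary3p12 (n : ℕ) (hn : 8 ≤ n) :
    (∃ X : FlipGraph.ColouredTriangulation n, X.IsFan ∧ X.IsMonochromatic) ∧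
    (∀ X : FlipGraph.ColouredTriangulation n, X.IsFan → X.IsMonochromatic →
      hypercubeGraph 4 ⊑
        ((FlipGraph.colouredFlipGraph n).connectedComponentMk X).toSimpleGraph ∧
      ¬ ((FlipGraph.colouredFlipGraph n).connectedComponentMk X).toSimpleGraph.IsPlanar) ∧
    ¬ (hypercubeGraph 4).IsPlanar := by
  refine ⟨⟨FlipGraph.colouredFan 0 false ∅ FlipGraph.isFlippable_empty,
    FlipGraph.isFan_fan_empty 0, FlipGraph.isMonochromatic_colouredFan_empty 0 false⟩,
    fun X hX hX' => ?_, not_isPlanar_hypercubeGraph_four⟩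
  obtain ⟨v, i, rfl⟩ := FlipGraph.ColouredTriangulation.exists_eq_colouredFan hX hX'
  have h := FlipGraph.hypercubeGraph_isContained_component 4 hn v i
  exact ⟨h, fun hP => not_isPlanar_hypercubeGraph_four (hP.of_isContained h)⟩
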